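/- For coprime positive integers $p,q$ let $(p',q')\in\mathbb N^2$ be the unique pair with $pp'-qq'=1$, $p'\le q$ and $q'<p$. For $\mu\in\mathbb C^*$, the Newton map $\sigma_{(p,q,\mu)}$ is the $\mathbb C$-algebra homomorphism $$\sigma_{(p,q,\mu)}:\mathbb C[[x,y]]\to\mathbb C[[x,y]],\qquad f(x,y)\mapsto f\bigl(\mu^{q'}x^p,\;x^q(y+\mu^{p'})\bigr).$$ For an ideal $I$ of $\mathbb C[[x,y]]$ and a Newton map $\sigma$, let $I_\sigma$ be the ideal generated by $\sigma(I)$; for a finite sequence $\Sigma_n=(\sigma_1,\dots,\sigma_n)$ of Newton maps put $I_{\Sigma_n}=(\cdots((I_{\sigma_1})_{\sigma_2})\cdots)_{\sigma_n}$ (and $I_{\Sigma_0}=I$). **Theorem.** Let $I$ be a nonzero ideal of $\mathbb C[[x,y]]$. 1. There is an integer $n_0\ge 0$ (depending on $I$) such that, for every $n\ge n_0$ and every sequence $\Sigma_n$ of $n$ Newton maps, the ideal $I_{\Sigma_n}$ is principal, generated by $x^k(y+h(x))^\nu$ for some $h\in x\mathbb C[[x]]$ and $(k,\nu)\in\mathbb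 N\times\mathbb N$. 2. Consequently the depth $d(I)\in\mathbb N$ is well defined by the following recursion: $d(I)=0$ if $I$ is generated by $x^k(y+h(x))^\nu$ for some $h\in x\mathbb C[[x]]$ and $(k,\nu)\in\mathbb N\times\mathbb N$; otherwise $d(I)=\max_\sigma d(I_\sigma)+1$, the maximum being taken over all Newton maps $\sigma$. That is, the recursion stops, all the maxima involved exist, and exactly one natural number is assigned to $I$. -/

import Mathlib

/-- The ring `ℂ[[x, y]]`, with `x = X 0` and `y = X 1`. -/
abbrev PS2 : Type := MvPowerSeries (Fin 2) ℂ

/-- The data of a Newton map `σ_{(p,q,μ)}`: positive integers `p, q`, a nonzero `μ`, and the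
natural numbers `p', q'` (written `p₁, q₁`) with `p p' - q q' = 1`, normalized by `p' ≤ q` and
`q' < p`, which makes them unique. The equation forces `gcd (p, q) = 1`. -/
structure NewtonDatum where
  p : ℕ
  q : ℕ
  p₁ : ℕ
  q₁ : ℕ
  μ : ℂ
  p_pos : 0 < p
  q_pos : 0 < q
  bezout : p * p₁ = q * q₁ + 1
  p₁_le : p₁ ≤ q
  q₁_lt : q₁ < p
  μ_ne : μ ≠ 0

namespace NewtonDatum

/-- The pair `(μ^{q'} x^p, x^q (y + μ^{p'}))` substituted for `(x, y)`. -/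
noncomputable def substitution (σ : NewtonDatum) : Fin 2 → PS2 :=
  ![MvPowerSeries.C (σ.μ ^ σ.q₁) * MvPowerSeries.X 0 ^ σ.p,
    MvPowerSeries.X 0 ^ σ.q * (MvPowerSeries.X 1 + MvPowerSeries.C (σ.μ ^ σ.p₁))]

theorem hasSubst_substitution (σ : NewtonDatum) : MvPowerSeries.HasSubst σ.substitution := by
  apply MvPowerSeries.hasSubst_of_constantCoeff_zero
  intro i
  fin_cases i
  · simp [substitution, σ.p_pos.ne']
  · simp [substitution, σ.q_pos.ne']

/-- The Newton map `f(x, y) ↦ f(μ^{q'} x^p, x^q (y + μ^{p'}))`. -/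
noncomputable def newtonMap (σ : NewtonDatum) : PS2 →ₐ[ℂ] PS2 :=
  MvPowerSeries.substAlgHom σ.hasSubst_substitution

end NewtonDatum

/-- `I_σ`, the ideal generated by the image of `I` under the Newton map `σ`. -/
noncomputable def Ideal.newtonTransform (I : Ideal PS2) (σ : NewtonDatum) : Ideal PS2 :=
  I.map σ.newtonMap

/-- `I_Σ` for a finite sequence `Σ = (σ₁, …, σₙ)` of Newton maps, `σ₁` being applied first. -/
noncomputable def Ideal.newtonTransformSeq (I : Ideal PS2) (S : List NewtonDatum) : Ideal PS2 :=
  S.foldl Ideal.newtonTransform I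

/-- `I` is principal, generated by `x^k (y + h(x))^ν` for some `k, ν ∈ ℕ` and `h ∈ x ℂ[[x]]`. -/
def Ideal.IsNewtonFinal (I : Ideal PS2) : Prop :=
  ∃ (k ν : ℕ) (h : PowerSeries ℂ), PowerSeries.X ∣ h ∧
    I = Ideal.span {(MvPowerSeries.X 0 : PS2) ^ k *
      (MvPowerSeries.X 1 + PowerSeries.subst (MvPowerSeries.X 0 : PS2) h) ^ ν}

/-- `I.HasNewtonDepth d` says that the recursion defining the depth of `I` assigns to `I` the
value `d`: the value is `0` if `I` is generated by some `x^k (y + h(x))^ν`; otherwise, each `I_σ`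
has a depth `D σ`, the maximum `m` of `D` over all Newton maps exists, and the value is `m + 1`. -/
inductive Ideal.HasNewtonDepth : Ideal PS2 → ℕ → Prop
  | zero (I : Ideal PS2) (hI : I.IsNewtonFinal) : Ideal.HasNewtonDepth I 0
  | succ (I : Ideal PS2) (hI : ¬ I.IsNewtonFinal) (D : NewtonDatum → ℕ) (m : ℕ)
      (hD : ∀ σ, Ideal.HasNewtonDepth (I.newtonTransform σ) (D σ))
      (hm : IsGreatest (Set.range D) m) : Ideal.HasNewtonDepth I (m + 1)

open MvPowerSeries

/-! Write a nonzero series as `f = x^k g`, where `g(0, y)` has finite order `ν` (`HasNewtonForm`). A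
Newton map reads off the face of lowest weight `p a + q b` of `g`: the new order is the multiplicity
of the centre `μ^{p'}` as a root of the face polynomial, whose degree is at most `ν`. So `ν` never
increases, and if it stays positive and constant then `p = 1` (`HasNewtonForm.newtonMap`).

Along an infinite path the orders of finitely many generators stabilize. If all become `0`, the
ideal is generated by a power of `x`. Otherwise eventually `p = 1`, and each generator is `x^k (y -
h)^ν` up to a unit, with `h` determined by the path alone (`eq_pow_mul_of_constant_order`). The
exponents `k` then grow proportionally to `ν`, so one generator finally divides all the others
(`exists_isNewtonFinal_of_path`).

A uniform bound follows as in König's lemma: final ideals remain final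
(`isNewtonFinal_newtonTransform`), and only finitely many Newton maps lead to a non-final transform
(`finite_not_isNewtonFinal`). The depth then exists by induction on this bound. -/

namespace NewtonTree

/-! ### Monomials and the order in `y` -/

/-- The exponent of the monomial `x^a y^b`. -/
noncomputable def expo (a b : ℕ) : Fin 2 →₀ ℕ := Finsupp.single 0 a + Finsupp.single 1 b

@[simp] theorem expo_apply_zero (a b : ℕ) : expo a b 0 = a := by simp [expo]

@[simp] theorem expo_apply_one (a b : ℕ) : expo a b 1 = b := by simp [expo]

theorem expo_apply (m : Fin 2 →₀ ℕ) : expo (m 0) (m 1) = m := by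
  ext i; fin_cases i <;> simp

theorem eq_expo_iff {m : Fin 2 →₀ ℕ} {a b : ℕ} : m = expo a b ↔ m 0 = a ∧ m 1 = b := by
  constructor
  · rintro rfl; simp
  · rintro ⟨rfl, rfl⟩; exact (expo_apply m).symm

theorem expo_add (a b c d : ℕ) : expo a b + expo c d = expo (a + c) (b + d) := by
  ext i; fin_cases i <;> simp

theorem X_zero_pow_eq (k : ℕ) : (X 0 : PS2) ^ k = monomial (expo k 0) 1 := by
  simp [X_pow_eq, expo]

theorem monomial_expo (a b : ℕ) (c : ℂ) :
    (monomial (expo a b) c : PS2) = C c * X 0 ^ a * X 1 ^ b := by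
  rw [X_pow_eq, X_pow_eq, ← monomial_zero_eq_C_apply, monomial_mul_monomial,
    monomial_mul_monomial]
  simp [expo]

theorem coeff_X_zero_pow_mul (k a b : ℕ) (f : PS2) :
    coeff (expo (k + a) b) (X 0 ^ k * f) = coeff (expo a b) f := by
  have h : expo (k + a) b = expo k 0 + expo a b := by rw [expo_add, zero_add]
  rw [X_zero_pow_eq, h, coeff_add_monomial_mul, one_mul]

theorem X_one_pow_dvd_of_dvd_mul {k ν : ℕ} {f : PS2} (h : X 1 ^ ν ∣ X 0 ^ k * f) :
    (X 1 : PS2) ^ ν ∣ f := by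
  rw [X_pow_dvd_iff] at h ⊢
  intro m hm
  rw [← expo_apply m, ← coeff_X_zero_pow_mul k]
  exact h _ (by simpa using hm)

/-- `f = x^k g`, where `g(0, y)` has order `ν`. -/
def HasNewtonForm (f : PS2) (k ν : ℕ) : Prop :=
  ∃ A U : PS2, IsUnit U ∧ f = X 0 ^ k * (X 0 * A + X 1 ^ ν * U)

theorem isUnit_X_zero_mul_add {A U : PS2} (hU : IsUnit U) : IsUnit (X 0 * A + U) := by
  rw [isUnit_iff_constantCoeff] at hU ⊢
  simpa using hU

theorem HasNewtonForm.eq_mul_unit {f : PS2} {k : ℕ} (h : HasNewtonForm f k 0) :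
    ∃ u, IsUnit u ∧ f = X 0 ^ k * u := by
  obtain ⟨A, U, hU, rfl⟩ := h
  exact ⟨X 0 * A + U, isUnit_X_zero_mul_add hU, by simp⟩

theorem HasNewtonForm.X_zero_pow_mul {f : PS2} {k ν : ℕ} (h : HasNewtonForm f k ν) (l : ℕ) :
    HasNewtonForm (X 0 ^ l * f) (l + k) ν := by
  obtain ⟨A, U, hU, rfl⟩ := h
  exact ⟨A, U, hU, by ring⟩

theorem HasNewtonForm.unit_mul {f u : PS2} {k ν : ℕ} (hu : IsUnit u)
    (h : HasNewtonForm f k ν) : HasNewtonForm (u * f) k ν := by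
  obtain ⟨A, U, hU, rfl⟩ := h
  exact ⟨u * A, u * U, hu.mul hU, by ring⟩

/-- A series not divisible by `x` is regular in `y` of some order. -/
theorem hasNewtonForm_of_coeff_ne_zero {g : PS2} {b₀ : ℕ} (hb₀ : coeff (expo 0 b₀) g ≠ 0) :
    ∃ ν, HasNewtonForm g 0 ν := by
  classical
  have hex : ∃ b, coeff (expo 0 b) g ≠ 0 := ⟨b₀, hb₀⟩
  set ν := Nat.find hex with hν
  let g₀ : PS2 := fun m => if m 0 = 0 then coeff m g else 0
  have hg₀ : ∀ m, coeff m g₀ = if m 0 = 0 then coeff m g else 0 := fun _ => rfl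
  obtain ⟨A, hA⟩ : (X 0 : PS2) ∣ g - g₀ := by
    rw [X_dvd_iff]
    intro m hm
    simp [hg₀, hm]
  obtain ⟨U, hU⟩ : (X 1 : PS2) ^ ν ∣ g₀ := by
    rw [X_pow_dvd_iff]
    intro m hm
    rw [hg₀]
    split_ifs with h0
    · have := Nat.find_min hex (hν ▸ hm)
      rw [← expo_apply m, h0]
      simpa using this
    · rfl
  refine ⟨ν, A, U, ?_, ?_⟩
  · rw [isUnit_iff_constantCoeff, isUnit_iff_ne_zero, ← coeff_zero_eq_constantCoeff_apply]
    have h1 : coeff (Finsupp.single 1 ν + 0) (X 1 ^ ν * U) = coeff 0 U := by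
      rw [X_pow_eq, coeff_add_monomial_mul, one_mul]
    rw [← h1, ← hU, hg₀]
    have h2 : coeff (expo 0 ν) g ≠ 0 := Nat.find_spec hex
    simpa [expo] using h2
  · rw [pow_zero, one_mul, ← hU, ← hA]; ring

theorem exists_hasNewtonForm {f : PS2} (hf : f ≠ 0) : ∃ k ν, HasNewtonForm f k ν := by
  classical
  have hex : ∃ a, ∃ b, coeff (expo a b) f ≠ 0 := by
    obtain ⟨m, hm⟩ := (MvPowerSeries.ne_zero_iff_exists_coeff_ne_zero f).1 hf
    exact ⟨m 0, m 1, by rwa [expo_apply]⟩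
  obtain ⟨g, hg⟩ : (X 0 : PS2) ^ Nat.find hex ∣ f := by
    rw [X_pow_dvd_iff]
    intro m hm
    have := Nat.find_min hex hm
    push Not at this
    rw [← expo_apply m]
    exact this _
  obtain ⟨b, hb⟩ := Nat.find_spec hex
  have hb' : coeff (expo 0 b) g ≠ 0 := by
    rw [← coeff_X_zero_pow_mul (Nat.find hex), ← hg]
    exact hb
  obtain ⟨ν, h⟩ := hasNewtonForm_of_coeff_ne_zero hb'
  exact ⟨_, ν, by rw [hg]; exact h.X_zero_pow_mul _⟩

theorem HasNewtonForm.coeff_ne_zero {g : PS2} {ν : ℕ} (h : HasNewtonForm g 0 ν) :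
    coeff (expo 0 ν) g ≠ 0 := by
  obtain ⟨A, U, hU, rfl⟩ := h
  rw [isUnit_iff_constantCoeff, isUnit_iff_ne_zero, ← coeff_zero_eq_constantCoeff_apply] at hU
  have h1 : coeff (expo 0 ν) (X 1 ^ ν * U) = coeff 0 U := by
    have : expo 0 ν = Finsupp.single 1 ν + 0 := by simp [expo]
    rw [this, X_pow_eq, coeff_add_monomial_mul, one_mul]
  have h2 : coeff (expo 0 ν) (X 0 * A) = 0 :=
    X_dvd_iff.1 (dvd_mul_right (X 0) A) _ (by simp)
  rw [pow_zero, one_mul, map_add, h1, h2, zero_add]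
  exact hU

/-! ### Newton maps and weights -/

theorem newtonMap_X_zero (σ : NewtonDatum) :
    σ.newtonMap (X 0) = C (σ.μ ^ σ.q₁) * X 0 ^ σ.p := by
  rw [NewtonDatum.newtonMap, substAlgHom_X]; rfl

theorem newtonMap_X_one (σ : NewtonDatum) :
    σ.newtonMap (X 1) = X 0 ^ σ.q * (X 1 + C (σ.μ ^ σ.p₁)) := by
  rw [NewtonDatum.newtonMap, substAlgHom_X]; rfl

theorem newtonMap_C (σ : NewtonDatum) (c : ℂ) : σ.newtonMap (C c) = C c :=
  σ.newtonMap.commutes c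

theorem isUnit_C {c : ℂ} (hc : c ≠ 0) : IsUnit (C c : PS2) :=
  (isUnit_iff_ne_zero.2 hc).map C

/-- `N` is a lower bound of the weights `p a + q b` of the monomials `x^a y^b` of `f`. -/
def WeightLE (p q N : ℕ) (f : PS2) : Prop :=
  ∀ m, coeff m f ≠ 0 → N ≤ p * m 0 + q * m 1

/-- Splitting `f = f(x, 0) + y f₁` reduces the claim to `f₁` with weight bound `N - q`, since `y`
itself maps to a multiple of `x^q`. This uses only that the Newton map is a ring homomorphism, so no
infinite sum of monomials has to be handled. -/
theorem X_zero_pow_dvd_newtonMap (σ : NewtonDatum) :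
    ∀ (N : ℕ) (f : PS2), WeightLE σ.p σ.q N f → X 0 ^ N ∣ σ.newtonMap f := by
  intro N
  induction N using Nat.strong_induction_on with
  | _ N ih =>
  intro f hf
  rcases Nat.eq_zero_or_pos N with rfl | hN
  · simp
  let f₀ : PS2 := fun m => if m 1 = 0 then coeff m f else 0
  have hf₀ : ∀ m, coeff m f₀ = if m 1 = 0 then coeff m f else 0 := fun _ => rfl
  obtain ⟨f₁, hf₁⟩ : (X 1 : PS2) ∣ f - f₀ := by
    rw [X_dvd_iff]
    intro m hm
    simp [hf₀, hm]
  have hdecomp : f = f₀ + X 1 * f₁ := by rw [← hf₁]; ring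
  have h0 : X 0 ^ N ∣ σ.newtonMap f₀ := by
    -- This is `N / p` rounded up, the least `a` with `p a ≥ N`.
    set a := (N + σ.p - 1) / σ.p with ha
    have hp := σ.p_pos
    obtain ⟨g, hg⟩ : (X 0 : PS2) ^ a ∣ f₀ := by
      rw [X_pow_dvd_iff]
      intro m hm
      rw [hf₀]
      split_ifs with h
      · by_contra hne
        have h1 := hf m hne
        rw [h, mul_zero, add_zero] at h1
        rw [ha, Nat.lt_div_iff_mul_lt hp] at hm
        have h2 : m 0 * σ.p = σ.p * m 0 := mul_comm _ _
        omega
      · rfl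
    have hle : N ≤ σ.p * a := by
      have h1 := Nat.div_add_mod (N + σ.p - 1) σ.p
      have h2 := Nat.mod_lt (N + σ.p - 1) hp
      rw [← ha] at h1
      omega
    rw [hg, map_mul, map_pow, newtonMap_X_zero, mul_pow, ← pow_mul]
    exact ((pow_dvd_pow _ hle).mul_left _).mul_right _
  have h1 : X 0 ^ (N - σ.q) ∣ σ.newtonMap f₁ := by
    refine ih _ (Nat.sub_lt hN σ.q_pos) _ fun m hm => ?_
    have h2 : coeff (Finsupp.single 1 1 + m) f = coeff m f₁ := by
      rw [hdecomp, map_add, hf₀, X, coeff_add_monomial_mul]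
      simp
    have h3 := hf (Finsupp.single 1 1 + m) (by rw [h2]; exact hm)
    simp [mul_add] at h3
    omega
  rw [hdecomp, map_add, map_mul, newtonMap_X_one]
  refine dvd_add h0 ?_
  have h4 : (X 0 : PS2) ^ N ∣ X 0 ^ σ.q * X 0 ^ (N - σ.q) := by
    rw [← pow_add]; exact pow_dvd_pow _ (by omega)
  exact h4.trans (mul_dvd_mul (dvd_mul_right _ _) h1)

/-! ### Faces of the Newton polygon -/

/-- The abscissa of the point with ordinate `b` on the line `p a + q b = N`. -/
def abscissa (p q N b : ℕ) : ℕ := (N - q * b) / p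

/-- The coefficient of `f` at the point with ordinate `b` of the line `p a + q b = N`. -/
noncomputable def faceCoeff (p q N : ℕ) (f : PS2) (b : ℕ) : ℂ :=
  if p * abscissa p q N b + q * b = N then coeff (expo (abscissa p q N b) b) f else 0

theorem weight_of_faceCoeff_ne_zero {p q N b : ℕ} {f : PS2} (h : faceCoeff p q N f b ≠ 0) :
    p * abscissa p q N b + q * b = N := by
  by_contra hne
  exact h (if_neg hne)

theorem coeff_of_faceCoeff_ne_zero {p q N b : ℕ} {f : PS2} (h : faceCoeff p q N f b ≠ 0) :
    coeff (expo (abscissa p q N b) b) f ≠ 0 := by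
  rwa [faceCoeff, if_pos (weight_of_faceCoeff_ne_zero h)] at h

theorem abscissa_eq {p q N a b : ℕ} (hp : 0 < p) (h : p * a + q * b = N) :
    abscissa p q N b = a := by
  rw [abscissa, ← h, Nat.add_sub_cancel, Nat.mul_div_cancel_left _ hp]

theorem faceCoeff_eq {p q N a b : ℕ} (hp : 0 < p) (h : p * a + q * b = N) (f : PS2) :
    faceCoeff p q N f b = coeff (expo a b) f := by
  rw [faceCoeff, abscissa_eq hp h, if_pos h]

/-- The polynomial of the face `p a + q b = N` of `f`, after the substitution `x = μ^{q'}`. -/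
noncomputable def facePoly (σ : NewtonDatum) (N : ℕ) (f : PS2) : Polynomial ℂ :=
  ∑ b ∈ Finset.range (N + 1), Polynomial.monomial b
    (faceCoeff σ.p σ.q N f b * (σ.μ ^ σ.q₁) ^ abscissa σ.p σ.q N b)

theorem coeff_facePoly (σ : NewtonDatum) (N : ℕ) (f : PS2) (b : ℕ) :
    (facePoly σ N f).coeff b =
      faceCoeff σ.p σ.q N f b * (σ.μ ^ σ.q₁) ^ abscissa σ.p σ.q N b := by
  rw [facePoly, Polynomial.finsetSum_coeff]
  simp only [Polynomial.coeff_monomial, Finset.sum_ite_eq', Finset.mem_range]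
  split_ifs with h
  · rfl
  · have : faceCoeff σ.p σ.q N f b = 0 := by
      by_contra hne
      have h1 := weight_of_faceCoeff_ne_zero hne
      have h2 := Nat.le_mul_of_pos_left b σ.q_pos
      omega
    rw [this, zero_mul]

theorem coeff_facePoly_ne_zero_iff (σ : NewtonDatum) (N : ℕ) (f : PS2) (b : ℕ) :
    (facePoly σ N f).coeff b ≠ 0 ↔ faceCoeff σ.p σ.q N f b ≠ 0 := by
  rw [coeff_facePoly]
  simp [σ.μ_ne]

theorem newtonMap_monomial_expo (σ : NewtonDatum) (a b : ℕ) (c : ℂ) :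
    σ.newtonMap (monomial (expo a b) c) = X 0 ^ (σ.p * a + σ.q * b) *
      (C (c * (σ.μ ^ σ.q₁) ^ a) * (X 1 + C (σ.μ ^ σ.p₁)) ^ b) := by
  rw [monomial_expo, map_mul, map_mul, map_pow, map_pow, newtonMap_X_zero, newtonMap_X_one,
    newtonMap_C, map_mul C, map_pow C (σ.μ ^ σ.q₁), mul_pow, mul_pow]
  ring

/-- Removing from `f` the finitely many terms of weight `N` leaves weights at least `N + 1`, whose
image is divisible by `x^{N+1}`; the removed terms are mapped explicitly. -/
theorem newtonMap_eq_facePoly (σ : NewtonDatum) {N : ℕ} {f : PS2}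
    (hf : WeightLE σ.p σ.q N f) :
    ∃ A, σ.newtonMap f = X 0 ^ N *
      (X 0 * A + Polynomial.aeval (X 1 + C (σ.μ ^ σ.p₁) : PS2) (facePoly σ N f)) := by
  classical
  set g : PS2 := ∑ b ∈ Finset.range (N + 1),
    monomial (expo (abscissa σ.p σ.q N b) b) (faceCoeff σ.p σ.q N f b) with hg
  have hgc : ∀ m, coeff m g = ∑ b ∈ Finset.range (N + 1),
      if m = expo (abscissa σ.p σ.q N b) b then faceCoeff σ.p σ.q N f b else 0 := by
    intro m
    rw [hg, map_sum]
    exact Finset.sum_congr rfl fun b _ => by rw [coeff_monomial]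
  have hw : WeightLE σ.p σ.q (N + 1) (f - g) := by
    intro m hm
    by_contra hlt
    apply hm
    rw [map_sub, hgc]
    rcases lt_or_ge (σ.p * m 0 + σ.q * m 1) N with h | h
    · have h0 : coeff m f = 0 := by
        by_contra hne
        exact absurd (hf m hne) (by omega)
      rw [h0, zero_sub, neg_eq_zero]
      refine Finset.sum_eq_zero fun b _ => ?_
      split_ifs with he
      · by_contra hne
        have h1 := weight_of_faceCoeff_ne_zero hne
        rw [eq_expo_iff] at he
        rw [← he.1, ← he.2] at h1
        rw [he.2] at h1
        rw [he.2] at h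
        omega
      · rfl
    · have hN : σ.p * m 0 + σ.q * m 1 = N := by omega
      have hm1 : m 1 < N + 1 := by
        have := Nat.le_mul_of_pos_left (m 1) σ.q_pos
        omega
      rw [Finset.sum_eq_single (m 1)]
      · rw [faceCoeff_eq σ.p_pos hN, abscissa_eq σ.p_pos hN, expo_apply, if_pos rfl, sub_self]
      · intro b _ hb
        rw [if_neg]
        rw [eq_expo_iff]
        exact fun h => hb h.2.symm
      · intro h'
        simp [hm1] at h'
  obtain ⟨A, hA⟩ := X_zero_pow_dvd_newtonMap σ (N + 1) _ hw
  refine ⟨A, ?_⟩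
  have hσg : σ.newtonMap g = X 0 ^ N *
      Polynomial.aeval (X 1 + C (σ.μ ^ σ.p₁) : PS2) (facePoly σ N f) := by
    rw [hg, facePoly, map_sum, map_sum, Finset.mul_sum]
    refine Finset.sum_congr rfl fun b _ => ?_
    rw [newtonMap_monomial_expo, Polynomial.aeval_monomial]
    by_cases h : faceCoeff σ.p σ.q N f b = 0
    · simp [h]
    · rw [weight_of_faceCoeff_ne_zero h]
      rfl
  have : f = (f - g) + g := by ring
  rw [this, map_add, hA, hσg]
  have : f - g + g = f := by ring
  rw [this]
  ring

theorem constantCoeff_aeval_add_C (r : ℂ) (Q : Polynomial ℂ) :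
    constantCoeff (Polynomial.aeval (X 1 + C r : PS2) Q) = Q.eval r := by
  rw [Polynomial.aeval_def, Polynomial.hom_eval₂]
  have h1 : (constantCoeff : PS2 →+* ℂ).comp (algebraMap ℂ PS2) = RingHom.id ℂ := by
    ext c
    change constantCoeff (C c : PS2) = c
    simp
  rw [h1]
  simp [Polynomial.eval₂_id]

theorem aeval_add_C_eq {P : Polynomial ℂ} (hP : P ≠ 0) (r : ℂ) :
    ∃ U : PS2, IsUnit U ∧
      Polynomial.aeval (X 1 + C r : PS2) P = X 1 ^ P.rootMultiplicity r * U := by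
  obtain ⟨Q, hQ, hdvd⟩ := Polynomial.exists_eq_pow_rootMultiplicity_mul_and_not_dvd P hP r
  refine ⟨Polynomial.aeval (X 1 + C r : PS2) Q, ?_, ?_⟩
  · rw [isUnit_iff_constantCoeff, constantCoeff_aeval_add_C, isUnit_iff_ne_zero]
    rwa [Polynomial.dvd_iff_isRoot] at hdvd
  · conv_lhs => rw [hQ]
    have : algebraMap ℂ PS2 r = C r := rfl
    simp [this]

/-! ### The order in `y` does not increase -/

/-- `N` is the least weight `p a + q b` of the monomials `x^a y^b` of `f`. -/
def IsLeastWeight (p q N : ℕ) (f : PS2) : Prop :=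
  WeightLE p q N f ∧ ∃ m, coeff m f ≠ 0 ∧ p * m 0 + q * m 1 = N

theorem exists_isLeastWeight (p q : ℕ) {f : PS2} (hf : f ≠ 0) : ∃ N, IsLeastWeight p q N f := by
  classical
  have hex : ∃ N m, coeff m f ≠ 0 ∧ p * m 0 + q * m 1 = N := by
    obtain ⟨m, hm⟩ := (ne_zero_iff_exists_coeff_ne_zero f).1 hf
    exact ⟨_, m, hm, rfl⟩
  exact ⟨Nat.find hex, fun m hm => Nat.find_min' hex ⟨m, hm, rfl⟩, Nat.find_spec hex⟩

theorem IsLeastWeight.exists_faceCoeff_ne_zero {p q N : ℕ} {f : PS2} (hp : 0 < p)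
    (h : IsLeastWeight p q N f) : ∃ b, faceCoeff p q N f b ≠ 0 := by
  obtain ⟨m, hm, hN⟩ := h.2
  exact ⟨m 1, by rwa [faceCoeff_eq hp hN, expo_apply]⟩

theorem IsLeastWeight.facePoly_ne_zero {σ : NewtonDatum} {N : ℕ} {f : PS2}
    (h : IsLeastWeight σ.p σ.q N f) : facePoly σ N f ≠ 0 := by
  obtain ⟨b, hb⟩ := h.exists_faceCoeff_ne_zero σ.p_pos
  intro h0
  rw [← coeff_facePoly_ne_zero_iff, h0] at hb
  simp at hb

theorem IsLeastWeight.hasNewtonForm {σ : NewtonDatum} {N : ℕ} {f : PS2}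
    (h : IsLeastWeight σ.p σ.q N f) :
    HasNewtonForm (σ.newtonMap f) N ((facePoly σ N f).rootMultiplicity (σ.μ ^ σ.p₁)) := by
  obtain ⟨A, hA⟩ := newtonMap_eq_facePoly σ h.1
  obtain ⟨U, hU, hP⟩ := aeval_add_C_eq h.facePoly_ne_zero (σ.μ ^ σ.p₁)
  exact ⟨A, U, hU, by rw [hA, hP]⟩

theorem le_of_faceCoeff_ne_zero {p q N b ν : ℕ} {f : PS2} (hq : 0 < q) (hN : N ≤ q * ν)
    (h : faceCoeff p q N f b ≠ 0) : b ≤ ν := by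
  have := weight_of_faceCoeff_ne_zero h
  have h' : q * b ≤ q * ν := by omega
  exact Nat.le_of_mul_le_mul_left h' hq

theorem IsLeastWeight.le_of_hasNewtonForm {p q N ν : ℕ} {g : PS2} (h : IsLeastWeight p q N g)
    (hg : HasNewtonForm g 0 ν) : N ≤ q * ν := by
  simpa using h.1 _ hg.coeff_ne_zero

theorem HasNewtonForm.ne_zero {g : PS2} {ν : ℕ} (h : HasNewtonForm g 0 ν) : g ≠ 0 := by
  rintro rfl
  exact h.coeff_ne_zero (by simp)

theorem coprime_p_q (σ : NewtonDatum) : Nat.Coprime σ.p σ.q := by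
  have h := σ.bezout
  have h1 : Nat.gcd σ.p σ.q ∣ σ.q * σ.q₁ + 1 := h ▸ (Nat.gcd_dvd_left _ _).mul_right _
  exact Nat.dvd_one.1 ((Nat.dvd_add_right ((Nat.gcd_dvd_right _ _).mul_right _)).1 h1)

/-- The point `(0, ν)` gives `N ≤ q ν`, so the face polynomial has degree at most `ν`. In the
equality case it is `c (y - r)^ν` with `r ≠ 0`, and in characteristic zero all its coefficients are
nonzero. The ordinate `ν` then gives `N = q ν`; the adjacent ordinates `ν` and `ν - 1` give `p ∣ q`,
hence `p = 1`. -/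
theorem HasNewtonForm.newtonMap_of_zero (σ : NewtonDatum) {g : PS2} {ν : ℕ}
    (hg : HasNewtonForm g 0 ν) :
    ∃ N ν', ν' ≤ ν ∧ HasNewtonForm (σ.newtonMap g) N ν' ∧
      (ν' = ν → N = σ.q * ν ∧ (0 < ν → σ.p = 1)) := by
  obtain ⟨N, hN⟩ := exists_isLeastWeight σ.p σ.q hg.ne_zero
  set P := facePoly σ N g with hP
  set r := σ.μ ^ σ.p₁ with hr
  have hr0 : r ≠ 0 := pow_ne_zero _ σ.μ_ne
  have hNν := hN.le_of_hasNewtonForm hg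
  have hP0 : P ≠ 0 := hN.facePoly_ne_zero
  have hdeg : P.natDegree ≤ ν := by
    rw [Polynomial.natDegree_le_iff_coeff_eq_zero]
    intro b hb
    by_contra hne
    rw [← ne_eq, hP, coeff_facePoly_ne_zero_iff] at hne
    exact absurd (le_of_faceCoeff_ne_zero σ.q_pos hNν hne) (by omega)
  have hmul : P.rootMultiplicity r ≤ P.natDegree := by
    have h1 := Polynomial.natDegree_le_of_dvd (Polynomial.pow_rootMultiplicity_dvd P r) hP0
    simpa using h1
  refine ⟨N, P.rootMultiplicity r, hmul.trans hdeg, hN.hasNewtonForm, fun heq => ?_⟩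
  obtain ⟨Q, hQ, -⟩ := Polynomial.exists_eq_pow_rootMultiplicity_mul_and_not_dvd P hP0 r
  rw [heq] at hQ
  have hQ0 : Q ≠ 0 := by rintro rfl; exact hP0 (by simpa using hQ)
  have hQdeg : Q.natDegree = 0 := by
    have h1 : P.natDegree = ν + Q.natDegree := by
      rw [hQ, Polynomial.natDegree_mul (pow_ne_zero _ (Polynomial.X_sub_C_ne_zero r)) hQ0]
      simp
    omega
  obtain ⟨c, rfl⟩ : ∃ c, Q = Polynomial.C c := ⟨_, Polynomial.eq_C_of_natDegree_eq_zero hQdeg⟩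
  have hc : c ≠ 0 := by rintro rfl; simp at hQ0
  have hcoeff : ∀ b ≤ ν, faceCoeff σ.p σ.q N g b ≠ 0 := by
    intro b hb
    rw [← coeff_facePoly_ne_zero_iff, ← hP, hQ, Polynomial.coeff_mul_C, sub_eq_add_neg,
      ← Polynomial.C_neg, Polynomial.coeff_X_add_C_pow]
    refine mul_ne_zero (mul_ne_zero (pow_ne_zero _ (neg_ne_zero.2 hr0)) ?_) hc
    exact_mod_cast (Nat.choose_pos hb).ne'
  have hwν := weight_of_faceCoeff_ne_zero (hcoeff ν le_rfl)
  refine ⟨by omega, fun hν => ?_⟩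
  have hw := weight_of_faceCoeff_ne_zero (hcoeff (ν - 1) (Nat.sub_le _ _))
  have h1 : σ.q * ν = σ.q * (ν - 1) + σ.q := by
    rw [← Nat.mul_succ, Nat.succ_eq_add_one, Nat.sub_add_cancel hν]
  have h2 : σ.p ∣ σ.q := ⟨abscissa σ.p σ.q N (ν - 1), by omega⟩
  exact Nat.Coprime.eq_one_of_dvd (coprime_p_q σ) h2

theorem newtonMap_X_zero_pow_mul (σ : NewtonDatum) (k : ℕ) (f : PS2) :
    ∃ u, IsUnit u ∧ σ.newtonMap (X 0 ^ k * f) = u * (X 0 ^ (σ.p * k) * σ.newtonMap f) := by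
  refine ⟨C ((σ.μ ^ σ.q₁) ^ k), isUnit_C (pow_ne_zero _ (pow_ne_zero _ σ.μ_ne)), ?_⟩
  rw [map_mul, map_pow, newtonMap_X_zero, mul_pow, map_pow C (σ.μ ^ σ.q₁)]
  ring

theorem HasNewtonForm.newtonMap (σ : NewtonDatum) {f : PS2} {k ν : ℕ}
    (hf : HasNewtonForm f k ν) :
    ∃ k' ν', ν' ≤ ν ∧ HasNewtonForm (σ.newtonMap f) k' ν' ∧
      (ν' = ν → k' = σ.p * k + σ.q * ν ∧ (0 < ν → σ.p = 1)) := by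
  obtain ⟨A, U, hU, rfl⟩ := hf
  obtain ⟨N, ν', hle, hform, heq⟩ :=
    HasNewtonForm.newtonMap_of_zero σ (g := X 0 * A + X 1 ^ ν * U) (ν := ν)
      ⟨A, U, hU, by simp⟩
  obtain ⟨u, hu, h⟩ := newtonMap_X_zero_pow_mul σ k (X 0 * A + X 1 ^ ν * U)
  refine ⟨σ.p * k + N, ν', hle, ?_, fun h' => ⟨by rw [(heq h').1], (heq h').2⟩⟩
  rw [h]
  exact (hform.X_zero_pow_mul _).unit_mul hu

/-! ### Finiteness of the exceptional Newton maps -/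

theorem IsLeastWeight.hasNewtonForm_zero {σ : NewtonDatum} {N : ℕ} {f : PS2}
    (h : IsLeastWeight σ.p σ.q N f) (hr : (facePoly σ N f).eval (σ.μ ^ σ.p₁) ≠ 0) :
    HasNewtonForm (σ.newtonMap f) N 0 := by
  have := h.hasNewtonForm
  rwa [Polynomial.rootMultiplicity_eq_zero hr] at this

theorem eval_facePoly (σ : NewtonDatum) (N : ℕ) (f : PS2) :
    (facePoly σ N f).eval (σ.μ ^ σ.p₁) = ∑ b ∈ Finset.range (N + 1),
      faceCoeff σ.p σ.q N f b * σ.μ ^ (σ.q₁ * abscissa σ.p σ.q N b + σ.p₁ * b) := by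
  rw [facePoly, Polynomial.eval_finsetSum]
  refine Finset.sum_congr rfl fun b _ => ?_
  rw [Polynomial.eval_monomial]
  ring

theorem lt_succ_of_faceCoeff_ne_zero {p q N b : ℕ} {f : PS2} (hq : 0 < q)
    (h : faceCoeff p q N f b ≠ 0) : b ∈ Finset.range (N + 1) := by
  have h1 := weight_of_faceCoeff_ne_zero h
  have h2 := Nat.le_mul_of_pos_left b hq
  rw [Finset.mem_range]
  omega

/-- The values of `μ` for which the face polynomial vanishes are roots of a nonzero polynomial. -/
noncomputable def facePolyInMu (p q p₁ q₁ N : ℕ) (f : PS2) : Polynomial ℂ :=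
  ∑ b ∈ Finset.range (N + 1),
    Polynomial.monomial (q₁ * abscissa p q N b + p₁ * b) (faceCoeff p q N f b)

theorem eval_facePolyInMu (σ : NewtonDatum) (N : ℕ) (f : PS2) :
    (facePolyInMu σ.p σ.q σ.p₁ σ.q₁ N f).eval σ.μ = (facePoly σ N f).eval (σ.μ ^ σ.p₁) := by
  rw [eval_facePoly, facePolyInMu, Polynomial.eval_finsetSum]
  exact Finset.sum_congr rfl fun b _ => Polynomial.eval_monomial

/-- By the Bézout relation, `p` times the exponent of `μ` attached to the ordinate `b` is `q₁ N +
b`. Distinct points of the face thus give distinct powers of `μ`, and no cancellation occurs. -/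
theorem facePolyInMu_ne_zero {p q p₁ q₁ N b : ℕ} {f : PS2} (hq : 0 < q)
    (hbez : p * p₁ = q * q₁ + 1) (hb : faceCoeff p q N f b ≠ 0) :
    facePolyInMu p q p₁ q₁ N f ≠ 0 := by
  have key : ∀ c, faceCoeff p q N f c ≠ 0 →
      p * (q₁ * abscissa p q N c + p₁ * c) = q₁ * N + c := by
    intro c hc
    have h1 := weight_of_faceCoeff_ne_zero hc
    calc p * (q₁ * abscissa p q N c + p₁ * c)
        = q₁ * (p * abscissa p q N c) + p * p₁ * c := by ring
      _ = q₁ * (p * abscissa p q N c + q * c) + c := by rw [hbez]; ring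
      _ = q₁ * N + c := by rw [h1]
  intro h0
  have h1 : (facePolyInMu p q p₁ q₁ N f).coeff (q₁ * abscissa p q N b + p₁ * b) =
      faceCoeff p q N f b := by
    rw [facePolyInMu, Polynomial.finsetSum_coeff, Finset.sum_eq_single b]
    · simp
    · intro c _ hcb
      rw [Polynomial.coeff_monomial]
      split_ifs with he
      · by_contra hc
        have h2 := key c hc
        rw [he, key b hb] at h2
        omega
      · rfl
    · intro h
      exact absurd (lt_succ_of_faceCoeff_ne_zero hq hb) h
  rw [h0] at h1
  exact hb (by simpa using h1.symm)

/-- The least abscissa of a monomial of `g` of ordinate `b`. -/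
noncomputable def leastAbscissa (g : PS2) (b : ℕ) : ℕ := sInf {a | coeff (expo a b) g ≠ 0}

/-- A point of the lowest line lies leftmost in its row. The bound is independent of `p`, `q` and
`N`. -/
theorem IsLeastWeight.abscissa_le {p q N b : ℕ} {g : PS2} (hp : 0 < p)
    (h : IsLeastWeight p q N g) (hb : faceCoeff p q N g b ≠ 0) :
    abscissa p q N b ≤ leastAbscissa g b := by
  have hmem : leastAbscissa g b ∈ {a | coeff (expo a b) g ≠ 0} :=
    Nat.sInf_mem ⟨_, coeff_of_faceCoeff_ne_zero hb⟩
  have h1 := h.1 _ hmem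
  have h2 := weight_of_faceCoeff_ne_zero hb
  simp only [expo_apply_zero, expo_apply_one] at h1
  have h3 : p * abscissa p q N b ≤ p * leastAbscissa g b := by omega
  exact Nat.le_of_mul_le_mul_left h3 hp

/-- If the face polynomial of `g` vanishes at the centre of `σ`, then the face has two points, and
so `p` and `q` are bounded in terms of `g`. -/
theorem le_of_eval_facePoly_eq_zero {σ : NewtonDatum} {N ν : ℕ} {g : PS2}
    (hg : HasNewtonForm g 0 ν) (hN : IsLeastWeight σ.p σ.q N g)
    (h0 : (facePoly σ N g).eval (σ.μ ^ σ.p₁) = 0) :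
    σ.p ≤ ν ∧ σ.q ≤ ∑ b ∈ Finset.range (ν + 1), leastAbscissa g b := by
  -- A face with a single point gives one monomial in `μ`, which cannot vanish at `μ ≠ 0`.
  obtain ⟨b, c, hlt, hb, hc⟩ : ∃ b c, b < c ∧ faceCoeff σ.p σ.q N g b ≠ 0 ∧
      faceCoeff σ.p σ.q N g c ≠ 0 := by
    obtain ⟨b, hb⟩ := hN.exists_faceCoeff_ne_zero σ.p_pos
    by_cases hex : ∃ c, c ≠ b ∧ faceCoeff σ.p σ.q N g c ≠ 0
    · obtain ⟨c, hcb, hc⟩ := hex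
      rcases lt_or_gt_of_ne hcb with h | h
      · exact ⟨c, b, h, hc, hb⟩
      · exact ⟨b, c, h, hb, hc⟩
    · push Not at hex
      rw [eval_facePoly, Finset.sum_eq_single b] at h0
      · exact absurd h0 (mul_ne_zero hb (pow_ne_zero _ σ.μ_ne))
      · intro c _ hcb
        rw [hex c hcb, zero_mul]
      · intro h
        exact absurd (lt_succ_of_faceCoeff_ne_zero σ.q_pos hb) h
  have hcν := le_of_faceCoeff_ne_zero σ.q_pos (hN.le_of_hasNewtonForm hg) hc
  have hwb := weight_of_faceCoeff_ne_zero hb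
  have hwc := weight_of_faceCoeff_ne_zero hc
  set a₁ := abscissa σ.p σ.q N b with ha₁
  set a₂ := abscissa σ.p σ.q N c
  have hqlt : σ.q * b < σ.q * c := Nat.mul_lt_mul_of_pos_left hlt σ.q_pos
  have ha : a₂ < a₁ := by
    have : σ.p * a₂ < σ.p * a₁ := by omega
    exact lt_of_mul_lt_mul_left' this
  have heq : σ.p * (a₁ - a₂) = σ.q * (c - b) := by
    rw [Nat.mul_sub, Nat.mul_sub]; omega
  have hcop := coprime_p_q σ
  have hp : σ.p ∣ c - b := hcop.dvd_of_dvd_mul_left ⟨_, heq.symm⟩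
  have hq : σ.q ∣ a₁ - a₂ := hcop.symm.dvd_of_dvd_mul_left ⟨_, heq⟩
  have hp' := Nat.le_of_dvd (by omega) hp
  have hq' := Nat.le_of_dvd (by omega) hq
  have ha₁' := hN.abscissa_le σ.p_pos hb
  have hsum : leastAbscissa g b ≤ ∑ b ∈ Finset.range (ν + 1), leastAbscissa g b :=
    Finset.single_le_sum (f := leastAbscissa g) (fun _ _ => Nat.zero_le _)
      (Finset.mem_range.2 (by omega))
  exact ⟨by omega, by omega⟩

theorem newtonDatum_ext {σ τ : NewtonDatum} (h₁ : σ.p = τ.p) (h₂ : σ.q = τ.q)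
    (h₃ : σ.p₁ = τ.p₁) (h₄ : σ.q₁ = τ.q₁) (h₅ : σ.μ = τ.μ) : σ = τ := by
  cases σ; cases τ
  simp only at h₁ h₂ h₃ h₄ h₅
  subst h₁ h₂ h₃ h₄ h₅
  rfl

/-- An exceptional map has its centre at a root of the face polynomial. This bounds `p` and `q`,
hence `p'` and `q'` by their normalization, and makes `μ` a root of one of finitely many nonzero
polynomials. -/
theorem finite_not_hasNewtonForm_zero {g : PS2} {ν : ℕ} (hg : HasNewtonForm g 0 ν) :
    {σ : NewtonDatum | ¬ ∃ k, HasNewtonForm (σ.newtonMap g) k 0}.Finite := by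
  set B := ∑ b ∈ Finset.range (ν + 1), leastAbscissa g b
  let M : ℕ := ν + B
  let key : NewtonDatum → (ℕ × ℕ) × (ℕ × ℕ) × ℂ := fun σ => ((σ.p, σ.q), (σ.p₁, σ.q₁), σ.μ)
  have hinj : Function.Injective key := by
    intro σ τ h
    simp only [key, Prod.mk.injEq] at h
    exact newtonDatum_ext h.1.1 h.1.2 h.2.1.1 h.2.1.2 h.2.2
  choose N hN using fun pq : ℕ × ℕ => exists_isLeastWeight pq.1 pq.2 hg.ne_zero
  let roots : (ℕ × ℕ) → (ℕ × ℕ) → Set ℂ := fun s t =>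
    {z | z ∈ (facePolyInMu s.1 s.2 t.1 t.2 (N s) g).roots}
  have hfin : (⋃ s ∈ (Set.Iic M ×ˢ Set.Iic M : Set (ℕ × ℕ)),
      ⋃ t ∈ (Set.Iic M ×ˢ Set.Iic M : Set (ℕ × ℕ)),
        (fun z => (s, t, z)) '' roots s t).Finite := by
    have hbox : (Set.Iic M ×ˢ Set.Iic M : Set (ℕ × ℕ)).Finite :=
      (Set.finite_Iic M).prod (Set.finite_Iic M)
    refine hbox.biUnion fun s _ => hbox.biUnion fun t _ => Set.Finite.image _ ?_
    exact Multiset.finite_toSet _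
  refine Set.Finite.of_finite_image (f := key) (hfin.subset ?_) hinj.injOn
  rintro _ ⟨σ, hσ, rfl⟩
  have hNσ : IsLeastWeight σ.p σ.q (N (σ.p, σ.q)) g := hN (σ.p, σ.q)
  have h0 : (facePoly σ (N (σ.p, σ.q)) g).eval (σ.μ ^ σ.p₁) = 0 := by
    by_contra hne
    exact hσ ⟨_, hNσ.hasNewtonForm_zero hne⟩
  obtain ⟨hp, hq⟩ := le_of_eval_facePoly_eq_zero hg hNσ h0
  have hp₁ := σ.p₁_le
  have hq₁ := σ.q₁_lt
  obtain ⟨b, hb⟩ := hNσ.exists_faceCoeff_ne_zero σ.p_pos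
  simp only [Set.mem_iUnion]
  refine ⟨(σ.p, σ.q), ⟨?_, ?_⟩, (σ.p₁, σ.q₁), ⟨?_, ?_⟩, σ.μ, ?_, rfl⟩
  · simp only [Set.mem_Iic, M]; omega
  · simp only [Set.mem_Iic, M]; omega
  · simp only [Set.mem_Iic, M]; omega
  · simp only [Set.mem_Iic, M]; omega
  · change σ.μ ∈ (facePolyInMu σ.p σ.q σ.p₁ σ.q₁ (N (σ.p, σ.q)) g).roots
    rw [Polynomial.mem_roots (facePolyInMu_ne_zero σ.q_pos σ.bezout hb), Polynomial.IsRoot,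
      eval_facePolyInMu, h0]

theorem finite_not_hasNewtonForm_zero_of_ne_zero {f : PS2} (hf : f ≠ 0) :
    {σ : NewtonDatum | ¬ ∃ k, HasNewtonForm (σ.newtonMap f) k 0}.Finite := by
  obtain ⟨k, ν, A, U, hU, rfl⟩ := exists_hasNewtonForm hf
  refine (finite_not_hasNewtonForm_zero (g := X 0 * A + X 1 ^ ν * U) (ν := ν)
    ⟨A, U, hU, by simp⟩).subset ?_
  rintro σ hσ ⟨l, hl⟩
  obtain ⟨u, hu, h⟩ := newtonMap_X_zero_pow_mul σ k (X 0 * A + X 1 ^ ν * U)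
  refine hσ ⟨σ.p * k + l, ?_⟩
  rw [h]
  exact (hl.X_zero_pow_mul _).unit_mul hu

/-! ### From series to ideals -/

theorem span_eq_of_forall_dvd {R : Type*} [CommRing R] {S : Set R} {a : R} (ha : a ∈ S)
    (h : ∀ b ∈ S, a ∣ b) : Ideal.span S = Ideal.span {a} := by
  apply le_antisymm
  · rw [Ideal.span_le]
    intro b hb
    exact Ideal.mem_span_singleton.2 (h b hb)
  · exact Ideal.span_mono (Set.singleton_subset_iff.2 ha)

theorem exists_finset_span_eq {I : Ideal PS2} (hI : I ≠ ⊥) :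
    ∃ s : Finset PS2, s.Nonempty ∧ (∀ f ∈ s, f ≠ 0) ∧ I = Ideal.span (s : Set PS2) := by
  classical
  obtain ⟨s, hs⟩ := (isNoetherianRing_iff_ideal_fg PS2).1 inferInstance I
  have h : I = Ideal.span ((s.erase 0 : Finset PS2) : Set PS2) := by
    rw [← hs, Finset.coe_erase, Ideal.span, Ideal.span, Submodule.span_sdiff_singleton_zero]
  refine ⟨s.erase 0, ?_, fun f hf => Finset.ne_of_mem_erase hf, h⟩
  rw [Finset.nonempty_iff_ne_empty]
  intro he
  rw [he] at h
  exact hI (by simpa using h)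

/-- Finitely many series of the form `x^k u` with `u` a unit generate the ideal of a power
of `x`. -/
theorem span_image_eq_span_X_zero_pow {s : Finset PS2} (hs : s.Nonempty) {φ : PS2 → PS2}
    (h : ∀ f ∈ s, ∃ k, HasNewtonForm (φ f) k 0) :
    ∃ k, Ideal.span (φ '' s) = Ideal.span {(X 0 : PS2) ^ k} := by
  classical
  have h' : ∀ f ∈ s, ∃ k u, IsUnit u ∧ φ f = X 0 ^ k * u := fun f hf => by
    obtain ⟨k, hk⟩ := h f hf
    exact ⟨k, hk.eq_mul_unit⟩
  choose! k u hu hk using h'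
  obtain ⟨f₀, hf₀, hmin⟩ := s.exists_min_image k hs
  refine ⟨k f₀, ?_⟩
  rw [span_eq_of_forall_dvd (Set.mem_image_of_mem φ hf₀)]
  · rw [hk f₀ hf₀]
    exact Ideal.span_singleton_mul_right_unit (hu f₀ hf₀) _
  · rintro _ ⟨f, hf, rfl⟩
    rw [hk f₀ hf₀, hk f hf, (hu f₀ hf₀).mul_right_dvd]
    exact (pow_dvd_pow _ (hmin f hf)).mul_right _

theorem isNewtonFinal_span_X_zero_pow (k : ℕ) :
    (Ideal.span {(X 0 : PS2) ^ k}).IsNewtonFinal :=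
  ⟨k, 0, 0, dvd_zero _, by simp⟩

/-- Outside the union of the exceptional sets of finitely many generators, every generator becomes a
power of `x` times a unit. -/
theorem finite_not_isNewtonFinal {I : Ideal PS2} (hI : I ≠ ⊥) :
    {σ : NewtonDatum | ¬ (I.newtonTransform σ).IsNewtonFinal}.Finite := by
  obtain ⟨s, hs, hs0, rfl⟩ := exists_finset_span_eq hI
  have hfin : (⋃ f ∈ s, {σ : NewtonDatum | ¬ ∃ k, HasNewtonForm (σ.newtonMap f) k 0}).Finite :=
    s.finite_toSet.biUnion fun f hf => finite_not_hasNewtonForm_zero_of_ne_zero (hs0 f hf)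
  refine hfin.subset fun σ hσ => ?_
  by_contra hnot
  simp only [Set.mem_iUnion, Set.mem_ofPred_eq, not_exists, exists_prop, not_and] at hnot
  have hnot' : ∀ f ∈ s, ∃ k, HasNewtonForm (σ.newtonMap f) k 0 := by
    intro f hf
    by_contra hne
    exact hnot f hf (not_exists.1 hne)
  obtain ⟨k, hk⟩ := span_image_eq_span_X_zero_pow hs hnot'
  apply hσ
  rw [Ideal.newtonTransform, Ideal.map_span, hk]
  exact isNewtonFinal_span_X_zero_pow k

/-! ### Shears and scalings -/

/-- The series `h(x)` in `ℂ[[x, y]]`. -/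
noncomputable def inX (h : PowerSeries ℂ) : PS2 := PowerSeries.subst (X 0 : PS2) h

theorem hasSubst_X_zero : PowerSeries.HasSubst (X 0 : PS2) := PowerSeries.HasSubst.X 0

theorem inX_neg (h : PowerSeries ℂ) : inX (-h) = -inX h := by
  simp only [inX, ← PowerSeries.coe_substAlgHom hasSubst_X_zero, map_neg]

theorem inX_add (h g : PowerSeries ℂ) : inX (h + g) = inX h + inX g :=
  PowerSeries.subst_add hasSubst_X_zero h g

theorem inX_mul (h g : PowerSeries ℂ) : inX (h * g) = inX h * inX g :=
  PowerSeries.subst_mul hasSubst_X_zero h g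

theorem inX_X_pow (n : ℕ) : inX (PowerSeries.X ^ n) = X 0 ^ n := by
  rw [inX, PowerSeries.subst_pow hasSubst_X_zero, PowerSeries.subst_X hasSubst_X_zero]

theorem inX_C (c : ℂ) : inX (PowerSeries.C c) = C c := PowerSeries.subst_C c

theorem X_zero_dvd_inX {h : PowerSeries ℂ} (hh : PowerSeries.X ∣ h) : X 0 ∣ inX h := by
  obtain ⟨g, rfl⟩ := hh
  rw [← pow_one PowerSeries.X, inX_mul, inX_X_pow, pow_one]
  exact dvd_mul_right _ _

theorem constantCoeff_eq_zero_of_X_zero_dvd {f : PS2} (h : X 0 ∣ f) : constantCoeff f = 0 := by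
  obtain ⟨g, rfl⟩ := h
  simp

theorem substAlgHom_inX {a : Fin 2 → PS2} (ha : HasSubst a) (h : PowerSeries ℂ) :
    substAlgHom (R := ℂ) ha (inX h) = PowerSeries.subst (a 0) h := by
  rw [substAlgHom_apply, inX, PowerSeries.subst_def, PowerSeries.subst_def,
    subst_comp_subst_apply hasSubst_X_zero.const ha, subst_X ha]

theorem substAlgHom_inX_of_eq {a : Fin 2 → PS2} (ha : HasSubst a) (h0 : a 0 = X 0)
    (h : PowerSeries ℂ) : substAlgHom (R := ℂ) ha (inX h) = inX h := by
  rw [substAlgHom_inX, h0, inX]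

theorem hasSubst_shear {h : PowerSeries ℂ} (hh : PowerSeries.X ∣ h) :
    HasSubst ![(X 0 : PS2), X 1 + inX h] := by
  apply hasSubst_of_constantCoeff_zero
  intro i
  fin_cases i
  · simp
  · simp [constantCoeff_eq_zero_of_X_zero_dvd (X_zero_dvd_inX hh)]

/-- The automorphism `f(x, y) ↦ f(x, y + h(x))`. -/
noncomputable def shear {h : PowerSeries ℂ} (hh : PowerSeries.X ∣ h) : PS2 →ₐ[ℂ] PS2 :=
  substAlgHom (hasSubst_shear hh)

theorem shear_X_zero {h : PowerSeries ℂ} (hh : PowerSeries.X ∣ h) : shear hh (X 0) = X 0 := by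
  rw [shear, substAlgHom_X]; rfl

theorem shear_X_one {h : PowerSeries ℂ} (hh : PowerSeries.X ∣ h) :
    shear hh (X 1) = X 1 + inX h := by
  rw [shear, substAlgHom_X]; rfl

theorem shear_inX {h : PowerSeries ℂ} (hh : PowerSeries.X ∣ h) (g : PowerSeries ℂ) :
    shear hh (inX g) = inX g := by
  rw [shear, substAlgHom_inX_of_eq (hasSubst_shear hh) (by simp) g]

theorem hasSubst_scale (q : ℕ) : HasSubst ![(X 0 : PS2), X 0 ^ q * X 1] := by
  apply hasSubst_of_constantCoeff_zero
  intro i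
  fin_cases i <;> simp

/-- The endomorphism `f(x, y) ↦ f(x, x^q y)`. -/
noncomputable def scale (q : ℕ) : PS2 →ₐ[ℂ] PS2 := substAlgHom (hasSubst_scale q)

theorem scale_X_zero (q : ℕ) : scale q (X 0) = X 0 := by
  rw [scale, substAlgHom_X]; rfl

theorem scale_X_one (q : ℕ) : scale q (X 1) = X 0 ^ q * X 1 := by
  rw [scale, substAlgHom_X]; rfl

theorem scale_inX (q : ℕ) (g : PowerSeries ℂ) : scale q (inX g) = inX g := by
  rw [scale, substAlgHom_inX_of_eq (hasSubst_scale q) (by simp) g]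

theorem coeff_scale (q a b : ℕ) (f : PS2) :
    coeff (expo (a + q * b) b) (scale q f) = coeff (expo a b) f := by
  classical
  rw [scale, substAlgHom_apply, coeff_subst (hasSubst_scale q)]
  have hprod : ∀ d : Fin 2 →₀ ℕ,
      (d.prod fun s e => (![(X 0 : PS2), X 0 ^ q * X 1] s) ^ e) =
        monomial (expo (d 0 + q * d 1) (d 1)) 1 := by
    intro d
    rw [Finsupp.prod_fintype _ _ (by simp), Fin.prod_univ_two, monomial_expo]
    simp
    ring
  rw [finsum_eq_single _ (expo a b)]
  · rw [hprod, coeff_monomial]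
    simp
  · intro d hd
    rw [hprod, coeff_monomial, if_neg, smul_zero]
    rw [eq_expo_iff]
    simp only [expo_apply_zero, expo_apply_one]
    rintro ⟨h1, rfl⟩
    exact hd (eq_expo_iff.2 ⟨by omega, rfl⟩)

/-- Two composites of substitutions agree if they agree on the variables. -/
theorem substAlgHom_substAlgHom_congr {a b a' b' : Fin 2 → PS2} (ha : HasSubst a)
    (hb : HasSubst b) (ha' : HasSubst a') (hb' : HasSubst b')
    (h : ∀ i, substAlgHom (R := ℂ) hb (a i) = substAlgHom (R := ℂ) hb' (a' i)) (f : PS2) :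
    substAlgHom (R := ℂ) hb (substAlgHom (R := ℂ) ha f) =
      substAlgHom (R := ℂ) hb' (substAlgHom (R := ℂ) ha' f) := by
  simp only [substAlgHom_apply] at h ⊢
  rw [subst_comp_subst_apply ha hb, subst_comp_subst_apply ha' hb', funext h]

theorem shear_neg_shear {h : PowerSeries ℂ} (hh : PowerSeries.X ∣ h)
    (hh' : PowerSeries.X ∣ -h) (f : PS2) : shear hh' (shear hh f) = f := by
  have key : ∀ i, shear hh' (![(X 0 : PS2), X 1 + inX h] i) = X i := by
    intro i
    fin_cases i
    · simp [shear_X_zero]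
    · simp [shear_X_one, shear_inX, inX_neg]
  simp only [shear, substAlgHom_apply] at key ⊢
  rw [subst_comp_subst_apply (hasSubst_shear hh) (hasSubst_shear hh'), funext key, subst_self]
  rfl

theorem bezout_of_p_eq_one {σ : NewtonDatum} (hp : σ.p = 1) : σ.q₁ = 0 ∧ σ.p₁ = 1 := by
  have h1 := σ.q₁_lt
  have h2 := σ.bezout
  have h3 : σ.q₁ = 0 := by omega
  rw [hp, h3] at h2
  exact ⟨h3, by omega⟩

theorem newtonMap_X_zero_of_p_eq_one {σ : NewtonDatum} (hp : σ.p = 1) :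
    σ.newtonMap (X 0) = X 0 := by
  rw [newtonMap_X_zero, (bezout_of_p_eq_one hp).1, hp]; simp

theorem newtonMap_X_one_of_p_eq_one {σ : NewtonDatum} (hp : σ.p = 1) :
    σ.newtonMap (X 1) = X 0 ^ σ.q * (X 1 + C σ.μ) := by
  rw [newtonMap_X_one, (bezout_of_p_eq_one hp).2, pow_one]

theorem substitution_zero_of_p_eq_one {σ : NewtonDatum} (hp : σ.p = 1) :
    σ.substitution 0 = X 0 := by
  rw [← newtonMap_X_zero_of_p_eq_one hp, NewtonDatum.newtonMap, substAlgHom_X]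

/-- Shears straighten a Newton map with `p = 1` into a scaling. -/
theorem shear_newtonMap {σ : NewtonDatum} (hp : σ.p = 1) {h h' : PowerSeries ℂ}
    (hh : PowerSeries.X ∣ h) (hh' : PowerSeries.X ∣ h')
    (heq : h = PowerSeries.X ^ σ.q * (PowerSeries.C σ.μ + h')) (f : PS2) :
    shear hh' (σ.newtonMap f) = scale σ.q (shear hh f) := by
  refine substAlgHom_substAlgHom_congr σ.hasSubst_substitution (hasSubst_shear hh')
    (hasSubst_shear hh) (hasSubst_scale σ.q) (fun i => ?_) f
  change shear hh' (σ.substitution i) = scale σ.q (![(X 0 : PS2), X 1 + inX h] i)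
  have hσ : σ.substitution i = σ.newtonMap (X i) := by
    rw [NewtonDatum.newtonMap, substAlgHom_X]
  rw [hσ]
  fin_cases i
  · simp [newtonMap_X_zero_of_p_eq_one hp, shear_X_zero, scale_X_zero]
  · have hC : ∀ c : ℂ, shear hh' (C c) = C c := fun c => (shear hh').commutes c
    simp only [Fin.mk_one, newtonMap_X_one_of_p_eq_one hp, map_mul, map_pow, map_add, shear_X_zero,
      shear_X_one, hC, Matrix.cons_val_one]
    rw [heq, inX_mul, inX_X_pow, inX_add, inX_C]
    simp only [Matrix.cons_val_fin_one, map_add, scale_X_one, map_mul, map_pow, scale_X_zero,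
      scale_inX]
    rw [← inX_C, scale_inX]
    ring

theorem HasNewtonForm.shear {f : PS2} {k ν : ℕ} (hf : HasNewtonForm f k ν)
    {h : PowerSeries ℂ} (hh : PowerSeries.X ∣ h) : HasNewtonForm (shear hh f) k ν := by
  obtain ⟨A, U, hU, rfl⟩ := hf
  obtain ⟨B, hB⟩ : (X 0 : PS2) ∣ (X 1 + inX h) ^ ν - X 1 ^ ν := by
    refine Dvd.dvd.trans ?_ (sub_dvd_pow_sub_pow _ _ ν)
    rw [add_sub_cancel_left]
    exact X_zero_dvd_inX hh
  refine ⟨NewtonTree.shear hh A + B * NewtonTree.shear hh U, NewtonTree.shear hh U,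
    hU.map _, ?_⟩
  rw [map_mul, map_pow, map_add, map_mul, map_mul, map_pow, shear_X_zero, shear_X_one,
    eq_add_of_sub_eq hB]
  ring

/-! ### The branch determined by a path with `p = 1` -/

/-- The coefficients of `h_n`, where `h_n = x^{q_n} (μ_n + h_{n+1})`. -/
noncomputable def branchCoeff (σ : ℕ → NewtonDatum) (n m : ℕ) : ℂ :=
  if m < (σ n).q then 0
  else if m = (σ n).q then (σ n).μ
  else branchCoeff σ (n + 1) (m - (σ n).q)
termination_by m
decreasing_by
  have := (σ n).q_pos
  omega

/-- The series `h_n = x^{q_n} (μ_n + x^{q_{n+1}} (μ_{n+1} + ⋯))`. -/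
noncomputable def branch (σ : ℕ → NewtonDatum) (n : ℕ) : PowerSeries ℂ :=
  PowerSeries.mk (branchCoeff σ n)

theorem X_dvd_branch (σ : ℕ → NewtonDatum) (n : ℕ) : PowerSeries.X ∣ branch σ n := by
  rw [PowerSeries.X_dvd_iff, ← PowerSeries.coeff_zero_eq_constantCoeff_apply, branch,
    PowerSeries.coeff_mk, branchCoeff, if_pos (σ n).q_pos]

theorem branch_eq (σ : ℕ → NewtonDatum) (n : ℕ) :
    branch σ n = PowerSeries.X ^ (σ n).q * (PowerSeries.C (σ n).μ + branch σ (n + 1)) := by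
  ext m
  rw [PowerSeries.coeff_X_pow_mul', branch, PowerSeries.coeff_mk, branchCoeff]
  rcases lt_trichotomy m (σ n).q with h | h | h
  · rw [if_pos h, if_neg h.not_ge]
  · have h0 := PowerSeries.X_dvd_iff.1 (X_dvd_branch σ (n + 1))
    simp [h, h0]
  · rw [if_neg h.not_gt, if_neg h.ne', if_pos h.le, map_add, PowerSeries.coeff_C,
      if_neg (Nat.sub_pos_of_lt h).ne', zero_add, branch, PowerSeries.coeff_mk]

/-- The total exponent `q_n + ⋯ + q_{n+j-1}`. -/
def qSum (σ : ℕ → NewtonDatum) (n j : ℕ) : ℕ := ∑ i ∈ Finset.range j, (σ (n + i)).q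

theorem qSum_succ (σ : ℕ → NewtonDatum) (n j : ℕ) :
    qSum σ n (j + 1) = qSum σ n j + (σ (n + j)).q :=
  Finset.sum_range_succ _ _

theorem le_qSum (σ : ℕ → NewtonDatum) (n j : ℕ) : j ≤ qSum σ n j := by
  induction j with
  | zero => simp
  | succ j ih =>
    have := (σ (n + j)).q_pos
    rw [qSum_succ]
    omega

theorem add_qSum_mul {σ : ℕ → NewtonDatum} {k : ℕ → ℕ} {ν n : ℕ}
    (hk : ∀ m ≥ n, k (m + 1) = k m + (σ m).q * ν) (j : ℕ) :
    k (n + j) = k n + qSum σ n j * ν := by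
  induction j with
  | zero => simp [qSum]
  | succ j ih =>
    rw [← add_assoc, hk _ (Nat.le_add_right _ _), ih, qSum_succ]
    ring

/-- If the order `ν` stays constant along a sequence of Newton maps with `p = 1`, then the series
is `x^k (y - h(x))^ν` up to a unit. -/
theorem eq_pow_mul_of_constant_order {σ : ℕ → NewtonDatum} {f : ℕ → PS2} {k : ℕ → ℕ} {ν n : ℕ}
    (hf : ∀ m ≥ n, f (m + 1) = (σ m).newtonMap (f m))
    (hform : ∀ m ≥ n, HasNewtonForm (f m) (k m) ν) (hp : ∀ m ≥ n, (σ m).p = 1)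
    (hk : ∀ m ≥ n, k (m + 1) = k m + (σ m).q * ν) :
    ∃ u, IsUnit u ∧ f n = X 0 ^ k n * (X 1 - inX (branch σ n)) ^ ν * u := by
  -- In coordinates that straighten the branch to `y = 0`, each Newton map becomes a scaling, which
  -- only moves coefficients.
  let F : ℕ → PS2 := fun m => shear (X_dvd_branch σ m) (f m)
  have hF : ∀ m ≥ n, F (m + 1) = scale (σ m).q (F m) := by
    intro m hm
    simp only [F]
    rw [hf m hm, shear_newtonMap (hp m hm) (X_dvd_branch σ m) _ (branch_eq σ m)]
  have hcoeff : ∀ j a b,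
      coeff (expo (a + qSum σ n j * b) b) (F (n + j)) = coeff (expo a b) (F n) := by
    intro j a b
    induction j with
    | zero => simp [qSum]
    | succ j ih =>
      have h1 : a + qSum σ n (j + 1) * b = a + qSum σ n j * b + (σ (n + j)).q * b := by
        rw [qSum_succ]; ring
      rw [h1, ← add_assoc n, hF _ (Nat.le_add_right _ _), coeff_scale, ih]
  have hFform : ∀ m ≥ n, HasNewtonForm (F m) (k m) ν := fun m hm => (hform m hm).shear _
  -- A coefficient at `(a, b)` with `b < ν` moves after `a + 1` steps to abscissa `a + S b`, where
  -- `S ≥ a + 1` is the sum of the `q`'s. This is below `S (b + 1) ≤ S ν`, hence below the power of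
  -- `x` dividing the series there, so the coefficient vanishes.
  have hdvd : X 1 ^ ν ∣ F n := by
    rw [X_pow_dvd_iff]
    intro m hm
    rw [← expo_apply m, ← hcoeff (m 0 + 1)]
    obtain ⟨A, U, -, hAU⟩ := hFform (n + (m 0 + 1)) (Nat.le_add_right _ _)
    have h1 : X 0 ^ k (n + (m 0 + 1)) ∣ F (n + (m 0 + 1)) := ⟨_, hAU⟩
    refine X_pow_dvd_iff.1 h1 _ ?_
    rw [expo_apply_zero, add_qSum_mul hk]
    have h2 := le_qSum σ n (m 0 + 1)
    have h3 : qSum σ n (m 0 + 1) * (m 1 + 1) ≤ qSum σ n (m 0 + 1) * ν :=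
      Nat.mul_le_mul_left _ hm
    rw [mul_add, mul_one] at h3
    omega
  obtain ⟨A, U, hU, hAU⟩ := hFform n le_rfl
  rw [hAU] at hdvd
  have h1 := X_one_pow_dvd_of_dvd_mul hdvd
  have h2 : (X 1 : PS2) ^ ν ∣ X 0 ^ 1 * A := by
    rw [pow_one]
    exact (dvd_add_left (dvd_mul_right _ _)).1 h1
  obtain ⟨B, rfl⟩ := X_one_pow_dvd_of_dvd_mul h2
  have hneg : PowerSeries.X ∣ -branch σ n := (dvd_neg).2 (X_dvd_branch σ n)
  refine ⟨shear hneg (X 0 * B + U), (isUnit_X_zero_mul_add hU).map _, ?_⟩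
  have h3 : F n = X 0 ^ k n * X 1 ^ ν * (X 0 * B + U) := by rw [hAU]; ring
  rw [← shear_neg_shear (X_dvd_branch σ n) hneg (f n)]
  change shear hneg (F n) = _
  rw [h3, map_mul, map_mul, map_pow, map_pow, shear_X_zero, shear_X_one, inX_neg, sub_eq_add_neg]

/-! ### Infinite paths reach a final ideal -/

/-- The composite of the first `n` Newton maps of a sequence. -/
noncomputable def pathMap (σ : ℕ → NewtonDatum) : ℕ → PS2 →+* PS2
  | 0 => RingHom.id PS2
  | n + 1 => ((σ n).newtonMap : PS2 →+* PS2).comp (pathMap σ n)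

theorem pathMap_succ (σ : ℕ → NewtonDatum) (n : ℕ) (f : PS2) :
    pathMap σ (n + 1) f = (σ n).newtonMap (pathMap σ n f) := rfl

theorem path_eq_map {σ : ℕ → NewtonDatum} {J : ℕ → Ideal PS2}
    (hJ : ∀ n, J (n + 1) = (J n).newtonTransform (σ n)) (n : ℕ) :
    J n = (J 0).map (pathMap σ n) := by
  induction n with
  | zero => exact (Ideal.map_id _).symm
  | succ n ih =>
    rw [hJ, Ideal.newtonTransform, ih, pathMap, ← Ideal.map_map]
    rfl

theorem exists_forms_along_path (σ : ℕ → NewtonDatum) {f : PS2} (hf : f ≠ 0) :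
    ∃ k ν : ℕ → ℕ, ∀ n, HasNewtonForm (pathMap σ n f) (k n) (ν n) ∧ ν (n + 1) ≤ ν n ∧
      (ν (n + 1) = ν n → k (n + 1) = (σ n).p * k n + (σ n).q * ν n ∧
        (0 < ν n → (σ n).p = 1)) := by
  let S : ℕ → Type := fun n => {t : ℕ × ℕ // HasNewtonForm (pathMap σ n f) t.1 t.2}
  have H : ∀ n (t : S n), ∃ t' : S (n + 1), t'.1.2 ≤ t.1.2 ∧
      (t'.1.2 = t.1.2 → t'.1.1 = (σ n).p * t.1.1 + (σ n).q * t.1.2 ∧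
        (0 < t.1.2 → (σ n).p = 1)) := by
    rintro n ⟨⟨k, ν⟩, h⟩
    obtain ⟨k', ν', hle, hform, heq⟩ := h.newtonMap (σ n)
    exact ⟨⟨(k', ν'), hform⟩, hle, heq⟩
  choose step hstep using H
  obtain ⟨k₀, ν₀, h₀⟩ := exists_hasNewtonForm hf
  let seq : ∀ n, S n := fun n => Nat.rec ⟨(k₀, ν₀), h₀⟩ step n
  exact ⟨fun n => (seq n).1.1, fun n => (seq n).1.2, fun n => ⟨(seq n).2, hstep n (seq n)⟩⟩

theorem eventually_constant {ν : ℕ → ℕ} (h : ∀ n, ν (n + 1) ≤ ν n) :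
    ∃ n₀, ∀ n ≥ n₀, ν n = ν n₀ := by
  have hanti : Antitone ν := antitone_nat_of_succ_le h
  obtain ⟨n₀, hn₀⟩ : ∃ n₀, ∀ n, ν n₀ ≤ ν n := by
    have hmem := Nat.sInf_mem (Set.range_nonempty ν)
    obtain ⟨n₀, hn₀⟩ := hmem
    exact ⟨n₀, fun n => hn₀ ▸ Nat.sInf_le ⟨n, rfl⟩⟩
  exact ⟨n₀, fun n hn => le_antisymm (hanti hn) (hn₀ n)⟩

theorem isNewtonFinal_span_unit_mul {k ν : ℕ} {h : PowerSeries ℂ} (hh : PowerSeries.X ∣ h)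
    {u : PS2} (hu : IsUnit u) :
    (Ideal.span {X 0 ^ k * (X 1 + inX h) ^ ν * u}).IsNewtonFinal :=
  ⟨k, ν, h, hh, Ideal.span_singleton_mul_right_unit hu _⟩

/-- Along an infinite sequence of Newton maps every nonzero ideal becomes final. -/
theorem exists_isNewtonFinal_of_path {σ : ℕ → NewtonDatum} {J : ℕ → Ideal PS2} (h0 : J 0 ≠ ⊥)
    (hJ : ∀ n, J (n + 1) = (J n).newtonTransform (σ n)) : ∃ n, (J n).IsNewtonFinal := by
  classical
  obtain ⟨s, hs, hs0, hspan⟩ := exists_finset_span_eq h0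
  have hJspan : ∀ n, J n = Ideal.span (pathMap σ n '' s) := fun n => by
    rw [path_eq_map hJ, hspan, Ideal.map_span]
  choose! k ν hkν using fun f (hf : f ∈ s) => exists_forms_along_path σ (hs0 f hf)
  have hev : ∀ f ∈ s, ∃ n₀, ∀ n ≥ n₀, ν f n = ν f n₀ := fun f hf =>
    eventually_constant fun n => (hkν f hf n).2.1
  choose! n₁ hn₁ using hev
  set n₀ := s.sup n₁ with hn₀
  have hconst : ∀ f ∈ s, ∀ n ≥ n₀, ν f n = ν f n₀ := by
    intro f hf n hn
    have h1 : n₁ f ≤ n₀ := Finset.le_sup hf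
    rw [hn₁ f hf n (h1.trans hn), hn₁ f hf n₀ h1]
  have hstep : ∀ f ∈ s, ∀ n ≥ n₀, k f (n + 1) = (σ n).p * k f n + (σ n).q * ν f n₀ ∧
      (0 < ν f n₀ → (σ n).p = 1) := by
    intro f hf n hn
    have h1 := (hkν f hf n).2.2 (by rw [hconst f hf n hn, hconst f hf (n + 1) (by omega)])
    rwa [hconst f hf n hn] at h1
  by_cases hpos : ∃ f ∈ s, 0 < ν f n₀
  · obtain ⟨f₁, hf₁, hν₁⟩ := hpos
    have hp : ∀ n ≥ n₀, (σ n).p = 1 := fun n hn => (hstep f₁ hf₁ n hn).2 hν₁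
    have hk : ∀ f ∈ s, ∀ n ≥ n₀, k f (n + 1) = k f n + (σ n).q * ν f n₀ := by
      intro f hf n hn
      rw [(hstep f hf n hn).1, hp n hn, one_mul]
    obtain ⟨g, hg, hmin⟩ := s.exists_min_image (fun f => toLex (ν f n₀, k f n₀)) hs
    -- If `ν f > ν g`, then over `j` more steps `k f` gains at least `j` more than `k g` does, which
    -- makes up for any initial deficit.
    set j := k g n₀ with hj
    set n := n₀ + j with hn
    -- The branch depends on the path only, so all generators share the factor `y - h`.
    have hform : ∀ f ∈ s, ∃ u, IsUnit u ∧
        pathMap σ n f = X 0 ^ k f n * (X 1 - inX (branch σ n)) ^ ν f n₀ * u := by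
      intro f hf
      refine eq_pow_mul_of_constant_order (f := fun m => pathMap σ m f) (n := n)
        (fun m _ => pathMap_succ σ m f) (fun m hm => ?_) (fun m hm => hp m (by omega))
        (fun m hm => hk f hf m (by omega))
      have h1 := (hkν f hf m).1
      rwa [hconst f hf m (by omega)] at h1
    choose! u hu hfu using hform
    refine ⟨n, ?_⟩
    rw [hJspan, span_eq_of_forall_dvd (Set.mem_image_of_mem _ hg)]
    · rw [hfu g hg, sub_eq_add_neg, ← inX_neg]
      exact isNewtonFinal_span_unit_mul ((dvd_neg).2 (X_dvd_branch σ n)) (hu g hg)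
    · rintro _ ⟨f, hf, rfl⟩
      have hlex := hmin f hf
      rw [Prod.Lex.toLex_le_toLex] at hlex
      have hν : ν g n₀ ≤ ν f n₀ := by
        rcases hlex with h | h
        · exact h.le
        · exact h.1.le
      have hkle : k g n ≤ k f n := by
        rw [hn, add_qSum_mul (hk g hg), add_qSum_mul (hk f hf)]
        rcases hlex with h | h
        · have h1 := le_qSum σ n₀ j
          have h2 : qSum σ n₀ j * (ν g n₀ + 1) ≤ qSum σ n₀ j * ν f n₀ :=
            Nat.mul_le_mul_left _ h
          rw [mul_add, mul_one] at h2
          omega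
        · have h1 : ν g n₀ = ν f n₀ := h.1
          have h2 : k g n₀ ≤ k f n₀ := h.2
          rw [h1]
          omega
      rw [hfu g hg, hfu f hf, (hu g hg).mul_right_dvd]
      exact (mul_dvd_mul (pow_dvd_pow _ hkle) (pow_dvd_pow _ hν)).mul_right _
  · push Not at hpos
    refine ⟨n₀, ?_⟩
    obtain ⟨l, hl⟩ := span_image_eq_span_X_zero_pow (φ := pathMap σ n₀) hs fun f hf =>
      ⟨k f n₀, by
        have h1 := (hkν f hf n₀).1
        rwa [Nat.le_zero.1 (hpos f hf)] at h1⟩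
    rw [hJspan, hl]
    exact isNewtonFinal_span_X_zero_pow l

/-! ### Final ideals stay final -/

theorem X_zero_ne_zero : (X 0 : PS2) ≠ 0 := by
  intro h
  have h1 := congrArg (coeff (Finsupp.single 0 1)) h
  simp [coeff_X] at h1

theorem hasNewtonForm_X_one_add {h : PowerSeries ℂ} (hh : PowerSeries.X ∣ h) :
    HasNewtonForm (X 1 + inX h) 0 1 := by
  obtain ⟨g, hg⟩ := X_zero_dvd_inX hh
  exact ⟨g, 1, isUnit_one, by rw [hg]; ring⟩

/-- A Newton map sends `y + h(x)` to `x^l u` or to `x^l (y + h'(x)) u`, with `u` a unit. -/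
theorem newtonMap_X_one_add (σ : NewtonDatum) {h : PowerSeries ℂ} (hh : PowerSeries.X ∣ h) :
    ∃ (l ε : ℕ) (h' : PowerSeries ℂ) (u : PS2), PowerSeries.X ∣ h' ∧ IsUnit u ∧
      σ.newtonMap (X 1 + inX h) = X 0 ^ l * (X 1 + inX h') ^ ε * u := by
  obtain ⟨l, ε, hε, hform, heq⟩ := (hasNewtonForm_X_one_add hh).newtonMap σ
  rcases Nat.lt_or_ge ε 1 with h1 | h1
  · obtain rfl : ε = 0 := by omega
    obtain ⟨u, hu, he⟩ := hform.eq_mul_unit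
    exact ⟨l, 0, 0, u, dvd_zero _, hu, by rw [he]; simp⟩
  · obtain rfl : ε = 1 := by omega
    obtain ⟨hl, hp⟩ := heq rfl
    have hp := hp one_pos
    rw [mul_zero, zero_add, mul_one] at hl
    subst hl
    have hσ : σ.newtonMap (X 1 + inX h) = X 0 ^ σ.q * (X 1 + C σ.μ) + inX h := by
      rw [map_add, newtonMap_X_one_of_p_eq_one hp]
      congr 1
      exact substAlgHom_inX_of_eq _ (substitution_zero_of_p_eq_one hp) h
    obtain ⟨A, U, hU, hAU⟩ := hform
    have hdvd : X 0 ^ σ.q ∣ inX h := by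
      have h2 : (X 0 : PS2) ^ σ.q ∣ X 0 ^ σ.q * (X 1 + C σ.μ) + inX h := ⟨_, hσ ▸ hAU⟩
      exact (dvd_add_right (dvd_mul_right _ _)).1 h2
    -- The image is `x^q (y + μ) + h`, and here it is divisible by `x^q`. So `h = x^q g` and the new
    -- series is `μ + g`; its constant term vanishes because the order in `y` is still `1`.
    obtain ⟨g, rfl⟩ : PowerSeries.X ^ σ.q ∣ h := by
      rw [PowerSeries.X_pow_dvd_iff]
      intro m hm
      have h2 := X_pow_dvd_iff.1 hdvd (Finsupp.single 0 m) (by simpa using hm)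
      rw [inX, PowerSeries.coeff_subst_single] at h2
      simpa using h2
    rw [inX_mul, inX_X_pow, ← mul_add, add_assoc, ← inX_C, ← inX_add] at hσ
    refine ⟨σ.q, 1, PowerSeries.C σ.μ + g, 1, ?_, isUnit_one, by rw [inX_mul, inX_X_pow, hσ]; simp⟩
    rw [inX_mul, inX_X_pow, hσ] at hAU
    have h3 : X 1 + inX (PowerSeries.C σ.μ + g) = X 0 * A + X 1 ^ 1 * U :=
      mul_left_cancel₀ (pow_ne_zero _ X_zero_ne_zero) hAU
    have h4 := congrArg constantCoeff h3
    rw [PowerSeries.X_dvd_iff, ← PowerSeries.coeff_zero_eq_constantCoeff_apply]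
    have h5 : coeff (Finsupp.single 0 0) (inX (PowerSeries.C σ.μ + g)) = 0 := by
      simpa using h4
    rw [inX, PowerSeries.coeff_subst_single] at h5
    simpa using h5

theorem isNewtonFinal_newtonTransform {I : Ideal PS2} (hI : I.IsNewtonFinal) (σ : NewtonDatum) :
    (I.newtonTransform σ).IsNewtonFinal := by
  obtain ⟨k, ν, h, hh, rfl⟩ := hI
  obtain ⟨l, ε, h', u, hh', hu, he⟩ := newtonMap_X_one_add σ hh
  obtain ⟨v, hv, hv'⟩ := newtonMap_X_zero_pow_mul σ k ((X 1 + inX h) ^ ν)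
  change (Ideal.map _ (Ideal.span {X 0 ^ k * (X 1 + inX h) ^ ν})).IsNewtonFinal
  rw [Ideal.map_span, Set.image_singleton]
  have h1 : σ.newtonMap (X 0 ^ k * (X 1 + inX h) ^ ν) =
      X 0 ^ (σ.p * k + l * ν) * (X 1 + inX h') ^ (ε * ν) * (v * u ^ ν) := by
    rw [hv', map_pow, he, mul_pow, mul_pow, ← pow_mul, ← pow_mul, pow_add]
    ring
  rw [h1]
  exact isNewtonFinal_span_unit_mul hh' (hv.mul (hu.pow ν))

/-! ### Uniform bound and depth -/

/-- All sequences of at least `n` Newton maps make `I` final. -/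
def FinalAfter (I : Ideal PS2) (n : ℕ) : Prop :=
  ∀ S : List NewtonDatum, n ≤ S.length → (I.newtonTransformSeq S).IsNewtonFinal

theorem newtonTransformSeq_cons (I : Ideal PS2) (σ : NewtonDatum) (S : List NewtonDatum) :
    I.newtonTransformSeq (σ :: S) = (I.newtonTransform σ).newtonTransformSeq S := rfl

theorem finalAfter_zero {I : Ideal PS2} (hI : I.IsNewtonFinal) : FinalAfter I 0 := by
  rintro S -
  induction S generalizing I with
  | nil => exact hI
  | cons σ S ih =>
    rw [newtonTransformSeq_cons]
    exact ih (isNewtonFinal_newtonTransform hI σ)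

theorem FinalAfter.mono {I : Ideal PS2} {m n : ℕ} (h : FinalAfter I m) (hmn : m ≤ n) :
    FinalAfter I n := fun S hS => h S (hmn.trans hS)

theorem finalAfter_succ_iff {I : Ideal PS2} {n : ℕ} :
    FinalAfter I (n + 1) ↔ ∀ σ, FinalAfter (I.newtonTransform σ) n := by
  constructor
  · intro h σ S hS
    rw [← newtonTransformSeq_cons]
    exact h _ (by simpa using hS)
  · rintro h (_ | ⟨σ, S⟩) hS
    · simp at hS
    · rw [newtonTransformSeq_cons]
      exact h σ S (by simpa using hS)

theorem newtonTransform_ne_bot {I : Ideal PS2} (hI : I ≠ ⊥) (σ : NewtonDatum) :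
    I.newtonTransform σ ≠ ⊥ := by
  obtain ⟨f, hf, hf0⟩ := Submodule.exists_mem_ne_zero_of_ne_bot hI
  obtain ⟨k, ν, hform⟩ := exists_hasNewtonForm hf0
  obtain ⟨k', ν', -, ⟨A, U, hU, h⟩, -⟩ := hform.newtonMap σ
  intro hbot
  have h1 : σ.newtonMap f ∈ I.newtonTransform σ := Ideal.mem_map_of_mem _ hf
  rw [hbot, Ideal.mem_bot, h] at h1
  have h2 : HasNewtonForm (X 0 * A + X 1 ^ ν' * U) 0 ν' := ⟨A, U, hU, by simp⟩
  exact mul_ne_zero (pow_ne_zero _ X_zero_ne_zero) h2.ne_zero h1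

/-- An ideal without a bound has a transform without a bound, since all but finitely many of its
transforms are final. -/
theorem exists_newtonTransform_not_finalAfter {I : Ideal PS2} (hI : I ≠ ⊥)
    (h : ¬ ∃ n, FinalAfter I n) : ∃ σ, ¬ ∃ n, FinalAfter (I.newtonTransform σ) n := by
  by_contra hall
  push Not at hall
  choose n hn using hall
  have hfin := finite_not_isNewtonFinal hI
  refine h ⟨hfin.toFinset.sup n + 1, finalAfter_succ_iff.2 fun σ => ?_⟩
  by_cases hσ : (I.newtonTransform σ).IsNewtonFinal
  · exact (finalAfter_zero hσ).mono (Nat.zero_le _)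
  · exact (hn σ).mono (Finset.le_sup (hfin.mem_toFinset.2 hσ))

/-- König's argument: without a bound, repeatedly choosing an unbounded transform yields an infinite
path that never meets a final ideal. -/
theorem exists_finalAfter {I : Ideal PS2} (hI : I ≠ ⊥) : ∃ n, FinalAfter I n := by
  by_contra hnot
  let T := {J : Ideal PS2 // J ≠ ⊥ ∧ ¬ ∃ n, FinalAfter J n}
  choose next hnext using fun J : T => exists_newtonTransform_not_finalAfter J.2.1 J.2.2
  let seq : ℕ → T := fun n => Nat.rec ⟨I, hI, hnot⟩
    (fun _ J => ⟨J.1.newtonTransform (next J), newtonTransform_ne_bot J.2.1 _, hnext J⟩) n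
  obtain ⟨n, hn⟩ := exists_isNewtonFinal_of_path (σ := fun n => next (seq n))
    (J := fun n => (seq n).1) hI fun _ => rfl
  exact (seq n).2.2 ⟨0, finalAfter_zero hn⟩

instance : Nonempty NewtonDatum := ⟨⟨1, 1, 1, 0, 1, by simp, by simp, by simp, by simp, by simp,
  by simp⟩⟩

/-- Although there are infinitely many Newton maps, the depths of the transforms have a common
bound, so their supremum is attained. -/
theorem exists_hasNewtonDepth_le {n : ℕ} : ∀ {I : Ideal PS2}, FinalAfter I n →
    ∃ d ≤ n, I.HasNewtonDepth d := by
  induction n with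
  | zero => exact fun {I} h => ⟨0, le_rfl, .zero I (h [] (Nat.zero_le _))⟩
  | succ n ih =>
    intro I h
    by_cases hI : I.IsNewtonFinal
    · exact ⟨0, Nat.zero_le _, .zero I hI⟩
    · choose D hDn hD using fun σ => ih (finalAfter_succ_iff.1 h σ)
      have hbdd : BddAbove (Set.range D) := ⟨n, by rintro _ ⟨σ, rfl⟩; exact hDn σ⟩
      have hmem := Nat.sSup_mem (Set.range_nonempty D) hbdd
      refine ⟨sSup (Set.range D) + 1, ?_, .succ I hI D _ hD ⟨hmem, fun x hx => le_csSup hbdd hx⟩⟩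
      obtain ⟨σ, hσ⟩ := hmem
      have := hDn σ
      omega

theorem hasNewtonDepth_unique {I : Ideal PS2} {d e : ℕ} (hd : I.HasNewtonDepth d)
    (he : I.HasNewtonDepth e) : d = e := by
  induction hd generalizing e with
  | zero I hI =>
    cases he with
    | zero => rfl
    | succ _ hI' => exact absurd hI hI'
  | succ I hI D m hD hm ih =>
    cases he with
    | zero _ hI' => exact absurd hI' hI
    | succ _ _ D' m' hD' hm' =>
      obtain rfl : D = D' := funext fun σ => ih σ (hD' σ)
      rw [hm.unique hm']

end NewtonTree

theorem mainTheorem5 (I : Ideal PS2) (hI : I ≠ ⊥) :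
    (∃ n₀ : ℕ, ∀ S : List NewtonDatum, n₀ ≤ S.length →
      (I.newtonTransformSeq S).IsNewtonFinal) ∧
    (∃! d : ℕ, I.HasNewtonDepth d) := by
  obtain ⟨n, hn⟩ := NewtonTree.exists_finalAfter hI
  obtain ⟨d, -, hd⟩ := NewtonTree.exists_hasNewtonDepth_le hn
  exact ⟨⟨n, hn⟩, d, hd, fun e he => NewtonTree.hasNewtonDepth_unique he hd⟩
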